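/- Let $d,n\ge 1$ be integers, let $\Sigma,\Sigma_2$ be (symmetric) positive definite real $d\times d$ matrices, let $\mu\in\mathbb R^d$ and let $x_1,\dots,x_n\in\mathbb R^d$ be a sample with mean $\bar x=\frac1n\sum_{i=1}^n x_i$. Consider the normal model $\mathcal N(\theta,\Sigma)$ with unknown mean $\theta\in\mathbb R^d$ and known covariance $\Sigma$, whose likelihood is $$\mathcal L(\theta)=\prod_{i=1}^n (2\pi)^{-d/2}\det(\Sigma)^{-1/2}\exp\Bigl(-\tfrac12 (x_i-\theta)^T\Sigma^{-1}(x_i-\theta)\Bigr).$$ Let $P_1$ be the posterior distribution of $\theta$ under the (improper) uniform prior, i.e. the normalisation of $\mathcal L(\theta)\,d\theta$ to a probability measure, and let $P_2$ be the posterior distribution of $\theta$ under the prior $\mathcal N(\mu,\Sigma_2)$, i.e. the normalisation of $\mathcal L\cdot\mathcal N(\mu,\Sigma_2)$. Let $\|\cdot\|$ be the Euclidean norm, $|\!|\!|A|\!|\!|=\sup_{\|x\|=1}\|Ax\|$ the operator norm, and $$d_{\mathcal W}(P_1,P_2)=\sup\Bigl\{\Bigl|\int h\,dP_1-\int h\,dP_2\Bigr|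 : h:\mathbb R^d\to\mathbb R \text{ Lipschitz with constant at most } 1\Bigr\}$$ the 1-Wasserstein distance. Then $P_1$ and $P_2$ are well-defined probability measures, against which all such $h$ are integrable, and $$d_{\mathcal W}(P_1,P_2)\le |\!|\!|\Sigma|\!|\!|\;|\!|\!|(\Sigma+n\Sigma_2)^{-1}|\!|\!|\;\|\bar x-\mu\| + \frac{\sqrt2\,\Gamma(d/2+1/2)}{\Gamma(d/2)}\,\frac{|\!|\!|\Sigma|\!|\!|}{n}\,|\!|\!|(\Sigma_2+n\Sigma_2\Sigma^{-1}\Sigma_2)^{-1/2}|\!|\!|.$$ -/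

import Mathlib

open MeasureTheory ProbabilityTheory
open scoped ENNReal NNReal Matrix MatrixOrder

namespace NormalPosterior

/-- The 1-Wasserstein distance in its dual form: the supremum of `|∫ h dP - ∫ h dQ|` over all
real functions `h` with Lipschitz constant at most `1`. It is meaningful for measures against which
all Lipschitz functions are integrable. -/
noncomputable def wassersteinDist {E : Type*} [PseudoEMetricSpace E] [MeasurableSpace E]
    (P Q : Measure E) : ℝ≥0∞ :=
  ⨆ (h : E → ℝ) (_ : LipschitzWith 1 h), ENNReal.ofReal |(∫ θ, h θ ∂P) - ∫ θ, h θ ∂Q|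

/-- The operator norm of a square matrix for the Euclidean norm. -/
noncomputable def opNorm {d : ℕ} (A : Matrix (Fin d) (Fin d) ℝ) : ℝ :=
  ‖Matrix.toEuclideanCLM (n := Fin d) (𝕜 := ℝ) A‖

/-- The density at `x` of the normal distribution with mean `θ` and covariance matrix `S`. -/
noncomputable def normalDensity {d : ℕ} (S : Matrix (Fin d) (Fin d) ℝ)
    (θ x : EuclideanSpace ℝ (Fin d)) : ℝ :=
  (2 * Real.pi) ^ (-(d : ℝ) / 2) * S.det ^ (-(1 / 2) : ℝ) *
    Real.exp (-(1 / 2) * ((x - θ).ofLp ⬝ᵥ (S⁻¹ *ᵥ (x - θ).ofLp)))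

/-- The likelihood of the parameter `θ` given an i.i.d. sample `x` from the normal distribution with
mean `θ` and covariance matrix `S`. -/
noncomputable def likelihood {d n : ℕ} (S : Matrix (Fin d) (Fin d) ℝ)
    (x : Fin n → EuclideanSpace ℝ (Fin d)) (θ : EuclideanSpace ℝ (Fin d)) : ℝ :=
  ∏ i, normalDensity S θ (x i)

/-- The posterior distribution for a likelihood `L` and a (possibly improper) prior `ν`: the measure
with density `L` with respect to `ν`, normalised to total mass one. -/
noncomputable def posteriorMeasure {Θ : Type*} [MeasurableSpace Θ]
    (L : Θ → ℝ) (ν : Measure Θ) : Measure Θ :=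
  (∫⁻ θ, ENNReal.ofReal (L θ) ∂ν)⁻¹ • ν.withDensity (fun θ ↦ ENNReal.ofReal (L θ))

/-- The posterior of the mean of a normal model under the uniform (Lebesgue) prior. -/
noncomputable def uniformPosterior {d n : ℕ} (S : Matrix (Fin d) (Fin d) ℝ)
    (x : Fin n → EuclideanSpace ℝ (Fin d)) : Measure (EuclideanSpace ℝ (Fin d)) :=
  posteriorMeasure (likelihood S x) volume

/-- The posterior of the mean of a normal model under the normal prior with mean `μ` and covariance
matrix `S₂`. -/
noncomputable def normalPosterior {d n : ℕ} (S : Matrix (Fin d) (Fin d) ℝ)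
    (x : Fin n → EuclideanSpace ℝ (Fin d)) (μ : EuclideanSpace ℝ (Fin d))
    (S₂ : Matrix (Fin d) (Fin d) ℝ) : Measure (EuclideanSpace ℝ (Fin d)) :=
  posteriorMeasure (likelihood S x) (multivariateGaussian μ S₂)

/-- The sample mean. -/
noncomputable def sampleMean {d n : ℕ} (x : Fin n → EuclideanSpace ℝ (Fin d)) :
    EuclideanSpace ℝ (Fin d) :=
  (n : ℝ)⁻¹ • ∑ i, x i

/-- The matrix power `A ^ (-1/2)` of a positive definite matrix `A`: the positive semidefinite
square root of the inverse of `A`. -/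
noncomputable def invSqrt {d : ℕ} (A : Matrix (Fin d) (Fin d) ℝ) : Matrix (Fin d) (Fin d) ℝ :=
  CFC.sqrt A⁻¹

end NormalPosterior

/-! Completing the square makes both posteriors Gaussian. With T = n S⁻¹ and U = S₂⁻¹ they are N(x̄,
T⁻¹) and N(x̄ - δ, (T + U)⁻¹), where δ = S (S + n S₂)⁻¹ (x̄ - μ). Realise them as the laws of x̄ + A
Z and x̄ - δ + B Z with one standard Gaussian Z, where A Aᵀ = T⁻¹ and B Bᵀ = (T + U)⁻¹. A
1-Lipschitz function changes by at most ‖δ‖ + ‖A - B‖ ‖Z‖ between the two, and the mean of ‖Z‖ is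
the Gamma quotient (`wassersteinDist_map_affine_le`, `integral_norm_stdGaussian`).

The bound on ‖A - B‖ (`exists_sqrt_close`) uses the freedom to take B non-symmetric. For R =
T^(-1/2), G = (1 + R U R)^(1/2), A = R and B = R G⁻¹, the difference factors as T⁻¹ (U B) (G + 1)⁻¹.
The last factor has norm at most 1, and (U B)(U B)ᵀ = U (T + U)⁻¹ U is the matrix whose square root
appears in the theorem. -/

namespace NormalPosterior

/-! ### Standard Gaussian measure: density and mean norm. -/

section Gaussian

variable {E : Type*} [NormedAddCommGroup E] [InnerProductSpace ℝ E] [FiniteDimensional ℝ E]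
  [MeasurableSpace E] [BorelSpace E]

lemma integrable_exp_neg_norm_sq_div_two :
    Integrable (fun x : E ↦ Real.exp (-‖x‖ ^ 2 / 2)) := by
  have h := (GaussianFourier.integrable_cexp_neg_mul_sq_norm_add (V := E) (b := 1 / 2)
    (by norm_num) 0 0).norm
  refine h.congr (ae_of_all _ fun x ↦ ?_)
  simp only [Complex.norm_exp, zero_mul, add_zero]
  norm_cast
  congr 1
  rw [show (-(1 / 2 : ℂ) * ((‖x‖ ^ 2 : ℝ) : ℂ)) = ((-‖x‖ ^ 2 / 2 : ℝ) : ℂ) by push_cast; ring,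
    Complex.ofReal_re]

lemma integral_exp_neg_norm_sq_div_two_pos :
    0 < ∫ x : E, Real.exp (-‖x‖ ^ 2 / 2) :=
  integral_exp_pos integrable_exp_neg_norm_sq_div_two

/-- The standard Gaussian measure has density proportional to `exp (-‖x‖ ^ 2 / 2)`. -/
lemma stdGaussian_eq_smul_withDensity :
    stdGaussian E = ENNReal.ofReal (∫ x : E, Real.exp (-‖x‖ ^ 2 / 2))⁻¹ •
      volume.withDensity (fun x : E ↦ ENNReal.ofReal (Real.exp (-‖x‖ ^ 2 / 2))) := by
  set C := ∫ x : E, Real.exp (-‖x‖ ^ 2 / 2) with hC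
  have hC0 : 0 < C := integral_exp_neg_norm_sq_div_two_pos
  have hfin : IsFiniteMeasure
      (volume.withDensity (fun x : E ↦ ENNReal.ofReal (Real.exp (-‖x‖ ^ 2 / 2)))) :=
    isFiniteMeasure_withDensity_ofReal integrable_exp_neg_norm_sq_div_two.hasFiniteIntegral
  have hfin' : IsFiniteMeasure (ENNReal.ofReal C⁻¹ •
      volume.withDensity (fun x : E ↦ ENNReal.ofReal (Real.exp (-‖x‖ ^ 2 / 2)))) :=
    Measure.smul_finite _ ENNReal.ofReal_ne_top
  -- The Fourier transform of the weight identifies the measure by its characteristic function; its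
  -- value at t = 0 is the normalising constant.
  have key (t : E) : ∫ x : E, Real.exp (-‖x‖ ^ 2 / 2) • Complex.exp (inner ℝ x t * Complex.I) =
      (Real.pi / (1 / 2 : ℂ)) ^ (Module.finrank ℝ E / 2 : ℂ) * Complex.exp (-‖t‖ ^ 2 / 2) := by
    have h := GaussianFourier.integral_cexp_neg_mul_sq_norm_add (V := E) (b := 1 / 2)
      (by norm_num) Complex.I t
    convert h using 2
    · ext x
      rw [Complex.real_smul, Complex.ofReal_exp, ← Complex.exp_add, real_inner_comm]
      congr 1
      push_cast
      ring
    · rw [Complex.I_sq]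
      congr 1
      ring
  have hCval : (C : ℂ) = (Real.pi / (1 / 2 : ℂ)) ^ (Module.finrank ℝ E / 2 : ℂ) := by
    have h := key 0
    simp only [inner_zero_right, Complex.ofReal_zero, zero_mul, Complex.exp_zero, norm_zero,
      Complex.real_smul, mul_one] at h
    rw [integral_complex_ofReal] at h
    simpa [hC] using h
  apply Measure.ext_of_charFun
  ext t
  rw [charFun_stdGaussian, charFun_apply, integral_smul_measure,
    integral_withDensity_eq_integral_toReal_smul (by fun_prop) (by simp)]
  simp only [ENNReal.toReal_ofReal (Real.exp_nonneg _)]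
  rw [key, ← hCval, ENNReal.toReal_ofReal (by positivity), Complex.real_smul, ← mul_assoc,
    ← Complex.ofReal_mul, inv_mul_cancel₀ hC0.ne', Complex.ofReal_one, one_mul]

lemma integrable_norm_stdGaussian : Integrable (fun x ↦ ‖x‖) (stdGaussian E) :=
  IsGaussian.integrable_id.norm

lemma integrable_stdGaussian_of_lipschitzWith {h : E → ℝ} {K : ℝ≥0} (hh : LipschitzWith K h) :
    Integrable h (stdGaussian E) := by
  refine ((integrable_norm_stdGaussian.const_mul (K : ℝ)).add
    (integrable_const |h 0|)).mono' hh.continuous.aestronglyMeasurable (ae_of_all _ fun x ↦ ?_)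
  have h1 := hh.dist_le_mul x 0
  rw [Real.dist_eq, dist_zero_right] at h1
  have h2 := abs_sub_abs_le_abs_sub (h x) (h 0)
  simp only [Real.norm_eq_abs, Pi.add_apply]
  linarith

/-- The mean of the chi distribution. -/
lemma integral_norm_stdGaussian [Nontrivial E] :
    ∫ x, ‖x‖ ∂(stdGaussian E) = Real.sqrt 2 *
      Real.Gamma ((Module.finrank ℝ E : ℝ) / 2 + 1 / 2) /
        Real.Gamma ((Module.finrank ℝ E : ℝ) / 2) := by
  set d := Module.finrank ℝ E with hd
  have hd0 : 0 < d := Module.finrank_pos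
  have hC0 : 0 < ∫ x : E, Real.exp (-‖x‖ ^ 2 / 2) := integral_exp_neg_norm_sq_div_two_pos
  -- In polar coordinates the mean norm is a ratio of two such integrals, with q = d above and q = d
  -- - 1 below; the ball volume cancels.
  have radial (q : ℕ) : ∫ y in Set.Ioi (0 : ℝ), y ^ q * Real.exp (-y ^ 2 / 2) =
      (1 / 2 : ℝ) ^ (-((q : ℝ) + 1) / 2) * (1 / 2) * Real.Gamma (((q : ℝ) + 1) / 2) := by
    rw [← integral_rpow_mul_exp_neg_mul_rpow (p := 2) (q := q) (b := 1 / 2) (by norm_num)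
      (by linarith [(Nat.cast_nonneg q : (0 : ℝ) ≤ q)]) (by norm_num)]
    refine setIntegral_congr_fun measurableSet_Ioi fun y _ ↦ ?_
    simp only [Real.rpow_natCast, Real.rpow_two]
    congr 2
    ring
  have hden := integral_fun_norm_addHaar (volume : Measure E)
    (fun y : ℝ ↦ Real.exp (-y ^ 2 / 2))
  have hnum := integral_fun_norm_addHaar (volume : Measure E)
    (fun y : ℝ ↦ Real.exp (-y ^ 2 / 2) * y)
  have hpow (y : ℝ) : y ^ (d - 1) * (Real.exp (-y ^ 2 / 2) * y) =
      y ^ d * Real.exp (-y ^ 2 / 2) := by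
    obtain ⟨k, hk⟩ := Nat.exists_eq_succ_of_ne_zero hd0.ne'
    rw [hk]
    simp only [Nat.succ_eq_add_one, Nat.add_sub_cancel]
    ring
  simp only [smul_eq_mul, ← hd, hpow, radial] at hden hnum
  have hcast : ((d - 1 : ℕ) : ℝ) = (d : ℝ) - 1 := by
    rw [Nat.cast_sub hd0, Nat.cast_one]
  rw [hcast] at hden
  rw [stdGaussian_eq_smul_withDensity, integral_smul_measure,
    integral_withDensity_eq_integral_toReal_smul (by fun_prop) (by simp)]
  simp only [ENNReal.toReal_ofReal (Real.exp_nonneg _), smul_eq_mul]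
  rw [ENNReal.toReal_ofReal (by positivity), hnum, hden]
  have hv : 0 < (volume : Measure E).real (Metric.ball 0 1) :=
    ENNReal.toReal_pos (Metric.measure_ball_pos _ _ one_pos).ne' measure_ball_lt_top.ne
  have hΓ : 0 < Real.Gamma ((d : ℝ) / 2) := Real.Gamma_pos_of_pos (by positivity)
  have hp : (1 / 2 : ℝ) ^ (-((d : ℝ) + 1) / 2) =
      Real.sqrt 2 * (1 / 2 : ℝ) ^ (-(d : ℝ) / 2) := by
    rw [show -((d : ℝ) + 1) / 2 = -(1 / 2) + -(d : ℝ) / 2 by ring,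
      Real.rpow_add (by norm_num), Real.rpow_neg (by norm_num), ← Real.sqrt_eq_rpow]
    congr 1
    rw [one_div, Real.sqrt_inv, inv_inv]
  have hq : 0 < (1 / 2 : ℝ) ^ (-(d : ℝ) / 2) := by positivity
  rw [show -((d : ℝ) - 1 + 1) / 2 = -(d : ℝ) / 2 by ring,
    show ((d : ℝ) - 1 + 1) / 2 = (d : ℝ) / 2 by ring, hp,
    show ((d : ℝ) + 1) / 2 = (d : ℝ) / 2 + 1 / 2 by ring]
  have hdR : (0 : ℝ) < d := by exact_mod_cast hd0
  simp only [nsmul_eq_mul]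
  field_simp

end Gaussian

/-! ### Normalisation and the synchronous coupling. -/

section Posterior

/-- Normalisation absorbs any finite nonzero factor, so later densities need only be known up to a
constant. -/
lemma posteriorMeasure_eq {Θ : Type*} [MeasurableSpace Θ] {L : Θ → ℝ} {ν P : Measure Θ}
    [IsProbabilityMeasure P] {c : ℝ≥0∞} (hc : c ≠ 0) (hc' : c ≠ ⊤)
    (h : ν.withDensity (fun θ ↦ ENNReal.ofReal (L θ)) = c • P) : posteriorMeasure L ν = P := by
  have h1 : ∫⁻ θ, ENNReal.ofReal (L θ) ∂ν = c := by
    rw [← setLIntegral_univ, ← withDensity_apply _ MeasurableSet.univ, h]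
    simp
  rw [posteriorMeasure, h1, h, smul_smul, ENNReal.inv_mul_cancel hc hc', one_smul]

lemma map_withDensity_comp {α β : Type*} [MeasurableSpace α] [MeasurableSpace β] (ν : Measure α)
    {g : α → β} (hg : Measurable g) {f : β → ℝ≥0∞} (hf : Measurable f) :
    (ν.withDensity (f ∘ g)).map g = (ν.map g).withDensity f := by
  ext s hs
  rw [Measure.map_apply hg hs, withDensity_apply _ (hg hs), withDensity_apply _ hs,
    setLIntegral_map hs hf hg]
  rfl

/-- The dual Wasserstein distance between two affine images of a measure is controlled by the
synchronous coupling. -/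
lemma wassersteinDist_map_affine_le {E : Type*} [NormedAddCommGroup E] [NormedSpace ℝ E]
    [MeasurableSpace E] [BorelSpace E] [SecondCountableTopology E] {γ : Measure E}
    [IsProbabilityMeasure γ] (hγ : Integrable (fun x ↦ ‖x‖) γ)
    (hlip : ∀ (h : E → ℝ) (K : ℝ≥0), LipschitzWith K h → Integrable h γ)
    (a b : E) (A B : E →L[ℝ] E) :
    wassersteinDist (γ.map (fun z ↦ a + A z)) (γ.map (fun z ↦ b + B z)) ≤
      ENNReal.ofReal (‖a - b‖ + ‖A - B‖ * ∫ x, ‖x‖ ∂γ) := by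
  refine iSup₂_le fun h hh ↦ ENNReal.ofReal_le_ofReal ?_
  have hint (c : E) (C : E →L[ℝ] E) : Integrable (fun z ↦ h (c + C z)) γ := by
    refine hlip _ ‖C‖₊ ?_
    have := hh.comp ((LipschitzWith.const c).add C.lipschitz)
    simpa [Function.comp_def] using this
  rw [integral_map (by fun_prop) hh.continuous.aestronglyMeasurable,
    integral_map (by fun_prop) hh.continuous.aestronglyMeasurable,
    ← integral_sub (hint a A) (hint b B)]
  calc |∫ z, h (a + A z) - h (b + B z) ∂γ|
      ≤ ∫ z, |h (a + A z) - h (b + B z)| ∂γ := abs_integral_le_integral_abs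
    _ ≤ ∫ z, (‖a - b‖ + ‖A - B‖ * ‖z‖) ∂γ := by
      refine integral_mono ((hint a A).sub (hint b B)).abs
        ((integrable_const _).add (hγ.const_mul _)) fun z ↦ ?_
      have h1 := hh.dist_le_mul (a + A z) (b + B z)
      rw [Real.dist_eq, dist_eq_norm, NNReal.coe_one, one_mul] at h1
      refine h1.trans ?_
      rw [show a + A z - (b + B z) = (a - b) + (A - B) z by
        rw [sub_apply]; abel]
      exact (norm_add_le _ _).trans (add_le_add le_rfl ((A - B).le_opNorm z))
    _ = ‖a - b‖ + ‖A - B‖ * ∫ x, ‖x‖ ∂γ := by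
      rw [integral_add (integrable_const _) (hγ.const_mul _), integral_const, integral_const_mul]
      simp

end Posterior

/-! ### Gaussian densities up to constants, and conjugacy. -/

section Density

variable {d : ℕ}

/-- The unnormalised Gaussian density with precision matrix `Λ` and linear term `ℓ`. -/
noncomputable def quadExp (Λ : Matrix (Fin d) (Fin d) ℝ) (ℓ : Fin d → ℝ)
    (θ : EuclideanSpace ℝ (Fin d)) : ℝ :=
  Real.exp (-(1 / 2) * (θ.ofLp ⬝ᵥ (Λ *ᵥ θ.ofLp)) + θ.ofLp ⬝ᵥ ℓ)

lemma quadExp_pos (Λ : Matrix (Fin d) (Fin d) ℝ) (ℓ : Fin d → ℝ)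
    (θ : EuclideanSpace ℝ (Fin d)) : 0 < quadExp Λ ℓ θ :=
  Real.exp_pos _

lemma continuous_quadExp (Λ : Matrix (Fin d) (Fin d) ℝ) (ℓ : Fin d → ℝ) :
    Continuous (quadExp Λ ℓ) := by
  unfold quadExp dotProduct Matrix.mulVec dotProduct
  fun_prop

lemma quadExp_mul (Λ Λ' : Matrix (Fin d) (Fin d) ℝ) (ℓ ℓ' : Fin d → ℝ)
    (θ : EuclideanSpace ℝ (Fin d)) :
    quadExp Λ ℓ θ * quadExp Λ' ℓ' θ = quadExp (Λ + Λ') (ℓ + ℓ') θ := by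
  simp only [quadExp, ← Real.exp_add, Matrix.add_mulVec, dotProduct_add]
  congr 1
  ring

lemma prod_quadExp {n : ℕ} (Λ : Matrix (Fin d) (Fin d) ℝ) (ℓ : Fin n → Fin d → ℝ)
    (θ : EuclideanSpace ℝ (Fin d)) :
    ∏ i, quadExp Λ (ℓ i) θ = quadExp ((n : ℝ) • Λ) (∑ i, ℓ i) θ := by
  simp only [quadExp, ← Real.exp_sum, Finset.sum_add_distrib, dotProduct_sum, Finset.sum_const,
    Finset.card_univ, Fintype.card_fin, Matrix.smul_mulVec, dotProduct_smul, nsmul_eq_mul,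
    smul_eq_mul]
  congr 1
  ring

lemma exp_neg_half_dotProduct_sub {Λ : Matrix (Fin d) (Fin d) ℝ} (hΛ : Λ.IsSymm)
    (x θ : EuclideanSpace ℝ (Fin d)) :
    Real.exp (-(1 / 2) * ((x - θ).ofLp ⬝ᵥ (Λ *ᵥ (x - θ).ofLp))) =
      Real.exp (-(1 / 2) * (x.ofLp ⬝ᵥ (Λ *ᵥ x.ofLp))) * quadExp Λ (Λ *ᵥ x.ofLp) θ := by
  have h : x.ofLp ⬝ᵥ (Λ *ᵥ θ.ofLp) = θ.ofLp ⬝ᵥ (Λ *ᵥ x.ofLp) := by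
    rw [Matrix.dotProduct_mulVec, ← Matrix.mulVec_transpose, hΛ.eq, dotProduct_comm]
  rw [quadExp, ← Real.exp_add, WithLp.ofLp_sub, Matrix.mulVec_sub, sub_dotProduct,
    dotProduct_sub, dotProduct_sub, h]
  congr 1
  ring

/-- Expanding each quadratic form, everything free of θ goes into k. -/
lemma exists_likelihood_eq {n : ℕ} {S : Matrix (Fin d) (Fin d) ℝ} (hS : S.PosDef)
    (x : Fin n → EuclideanSpace ℝ (Fin d)) :
    ∃ k : ℝ, 0 < k ∧
      likelihood S x = fun θ ↦ k * quadExp ((n : ℝ) • S⁻¹) (∑ i, S⁻¹ *ᵥ (x i).ofLp) θ := by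
  have hsymm : S⁻¹.IsSymm := by
    have := hS.inv.isHermitian
    rwa [Matrix.IsHermitian, Matrix.conjTranspose_eq_transpose_of_trivial] at this
  have hdet := hS.det_pos
  refine ⟨∏ i, ((2 * Real.pi) ^ (-(d : ℝ) / 2) * S.det ^ (-(1 / 2) : ℝ) *
    Real.exp (-(1 / 2) * ((x i).ofLp ⬝ᵥ (S⁻¹ *ᵥ (x i).ofLp)))),
    Finset.prod_pos fun i _ ↦ by positivity, ?_⟩
  ext θ
  rw [← prod_quadExp, ← Finset.prod_mul_distrib, likelihood]
  refine Finset.prod_congr rfl fun i _ ↦ ?_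
  rw [normalDensity, exp_neg_half_dotProduct_sub hsymm, mul_assoc, mul_assoc, mul_assoc]

/-- The image of the standard Gaussian measure under `z ↦ b + B z`. -/
noncomputable def affineGaussian (b : EuclideanSpace ℝ (Fin d)) (B : Matrix (Fin d) (Fin d) ℝ) :
    Measure (EuclideanSpace ℝ (Fin d)) :=
  (stdGaussian (EuclideanSpace ℝ (Fin d))).map
    (fun z ↦ b + Matrix.toEuclideanCLM (𝕜 := ℝ) B z)

instance (b : EuclideanSpace ℝ (Fin d)) (B : Matrix (Fin d) (Fin d) ℝ) :
    IsProbabilityMeasure (affineGaussian b B) :=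
  Measure.isProbabilityMeasure_map (Measurable.aemeasurable (by fun_prop))

lemma integrable_affineGaussian (b : EuclideanSpace ℝ (Fin d)) (B : Matrix (Fin d) (Fin d) ℝ)
    {h : EuclideanSpace ℝ (Fin d) → ℝ} (hh : LipschitzWith 1 h) :
    Integrable h (affineGaussian b B) := by
  rw [affineGaussian, integrable_map_measure hh.continuous.aestronglyMeasurable
    (Measurable.aemeasurable (by fun_prop))]
  exact integrable_stdGaussian_of_lipschitzWith
    (hh.comp ((LipschitzWith.const b).add (Matrix.toEuclideanCLM (𝕜 := ℝ) B).lipschitz))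

lemma map_affine_volume (b : EuclideanSpace ℝ (Fin d)) {B : Matrix (Fin d) (Fin d) ℝ}
    (hB : B.det ≠ 0) :
    ∃ c : ℝ≥0∞, c ≠ 0 ∧ c ≠ ⊤ ∧
      (volume : Measure (EuclideanSpace ℝ (Fin d))).map
        (fun z ↦ b + Matrix.toEuclideanCLM (𝕜 := ℝ) B z) = c • volume := by
  have hdet : LinearMap.det (Matrix.toEuclideanLin B) ≠ 0 := by
    rwa [Matrix.toEuclideanLin_eq_toLin_orthonormal, LinearMap.det_toLin]
  refine ⟨ENNReal.ofReal |(LinearMap.det (Matrix.toEuclideanLin B))⁻¹|, ?_,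
    ENNReal.ofReal_ne_top, ?_⟩
  · simpa using hdet
  · have h := Measure.map_linearMap_addHaar_eq_smul_addHaar
      (volume : Measure (EuclideanSpace ℝ (Fin d))) hdet
    have hcomp : (fun z ↦ b + Matrix.toEuclideanCLM (𝕜 := ℝ) B z) =
        (fun z ↦ b + z) ∘ (Matrix.toEuclideanLin B) := rfl
    rw [hcomp, ← Measure.map_map (by fun_prop)
      (LinearMap.continuous_of_finiteDimensional _).measurable, h, Measure.map_smul,
      map_add_left_eq_self]

/-- The Gaussian measure with covariance `B * Bᵀ = Λ⁻¹` and mean `b` has a density proportional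
to `quadExp Λ (Λ *ᵥ b)`. -/
lemma exists_affineGaussian_eq (b : EuclideanSpace ℝ (Fin d)) {B Λ : Matrix (Fin d) (Fin d) ℝ}
    (hΛ : Λ.IsSymm) (hB : Λ * (B * Bᵀ) = 1) :
    ∃ c : ℝ≥0∞, c ≠ 0 ∧ c ≠ ⊤ ∧ affineGaussian b B =
      c • volume.withDensity (fun θ ↦ ENNReal.ofReal (quadExp Λ (Λ *ᵥ b.ofLp) θ)) := by
  have hdet : B.det ≠ 0 := by
    intro h0
    have := congrArg Matrix.det hB
    simp [Matrix.det_mul, h0] at this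
  have hB' : Bᵀ * (Λ * B) = 1 := by
    rw [mul_eq_one_comm, Matrix.mul_assoc, hB]
  obtain ⟨c₁, hc₁, hc₁', hvol⟩ := map_affine_volume b hdet
  set k : ℝ := Real.exp (-(1 / 2) * (b.ofLp ⬝ᵥ (Λ *ᵥ b.ofLp))) with hk
  have hk0 : 0 < k := Real.exp_pos _
  -- Since Bᵀ Λ B = 1, the form Λ evaluated at B z is ‖z‖², so the standard weight is a pullback
  -- along the affine map.
  have hcomp : (fun x : EuclideanSpace ℝ (Fin d) ↦ ENNReal.ofReal (Real.exp (-‖x‖ ^ 2 / 2))) =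
      (ENNReal.ofReal k • fun θ ↦ ENNReal.ofReal (quadExp Λ (Λ *ᵥ b.ofLp) θ)) ∘
        (fun z ↦ b + Matrix.toEuclideanCLM (𝕜 := ℝ) B z) := by
    ext z
    simp only [Function.comp_apply, Pi.smul_apply, smul_eq_mul]
    rw [← ENNReal.ofReal_mul hk0.le, hk, ← exp_neg_half_dotProduct_sub hΛ]
    congr 2
    have h1 : (b - (b + Matrix.toEuclideanCLM (𝕜 := ℝ) B z)).ofLp = -(B *ᵥ z.ofLp) := by
      rw [sub_add_cancel_left, WithLp.ofLp_neg, Matrix.ofLp_toEuclideanCLM]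
    rw [h1, Matrix.mulVec_neg, neg_dotProduct_neg, dotProduct_comm, Matrix.dotProduct_mulVec,
      Matrix.mulVec_mulVec, ← Matrix.mulVec_transpose, dotProduct_comm,
      Matrix.mulVec_mulVec, hB', Matrix.one_mulVec, EuclideanSpace.real_norm_sq_eq]
    simp only [dotProduct, pow_two]
    ring
  have hC0 : 0 < ∫ x : EuclideanSpace ℝ (Fin d), Real.exp (-‖x‖ ^ 2 / 2) :=
    integral_exp_neg_norm_sq_div_two_pos
  have hmeas : Measurable
      (fun θ ↦ ENNReal.ofReal (quadExp Λ (Λ *ᵥ b.ofLp) θ)) :=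
    (continuous_quadExp _ _).measurable.ennreal_ofReal
  refine ⟨ENNReal.ofReal (∫ x : EuclideanSpace ℝ (Fin d), Real.exp (-‖x‖ ^ 2 / 2))⁻¹ *
    (c₁ * ENNReal.ofReal k), ?_, ?_, ?_⟩
  · have := ENNReal.ofReal_pos.2 (inv_pos.2 hC0)
    have := ENNReal.ofReal_pos.2 hk0
    exact mul_ne_zero (by positivity) (mul_ne_zero hc₁ (by positivity))
  · exact ENNReal.mul_ne_top ENNReal.ofReal_ne_top
      (ENNReal.mul_ne_top hc₁' ENNReal.ofReal_ne_top)
  · rw [affineGaussian, stdGaussian_eq_smul_withDensity, Measure.map_smul, hcomp,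
      map_withDensity_comp _ (by fun_prop) (hmeas.const_smul _), hvol, withDensity_smul_measure,
      withDensity_smul _ hmeas, smul_smul, smul_smul, mul_assoc]

lemma withDensity_const_mul_quadExp {ν : Measure (EuclideanSpace ℝ (Fin d))} {k : ℝ} (hk : 0 < k)
    (Λ : Matrix (Fin d) (Fin d) ℝ) (ℓ : Fin d → ℝ) :
    ν.withDensity (fun θ ↦ ENNReal.ofReal (k * quadExp Λ ℓ θ)) =
      ENNReal.ofReal k • ν.withDensity (fun θ ↦ ENNReal.ofReal (quadExp Λ ℓ θ)) := by
  rw [← withDensity_smul _ (continuous_quadExp _ _).measurable.ennreal_ofReal]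
  congr 1
  ext θ
  rw [ENNReal.ofReal_mul hk.le, Pi.smul_apply, smul_eq_mul]

lemma posteriorMeasure_volume_eq (b : EuclideanSpace ℝ (Fin d))
    {B Λ : Matrix (Fin d) (Fin d) ℝ} (hΛ : Λ.IsSymm) (hB : Λ * (B * Bᵀ) = 1)
    {k : ℝ} (hk : 0 < k) :
    posteriorMeasure (fun θ ↦ k * quadExp Λ (Λ *ᵥ b.ofLp) θ) volume = affineGaussian b B := by
  obtain ⟨c, hc, hc', h⟩ := exists_affineGaussian_eq b hΛ hB
  refine posteriorMeasure_eq (c := ENNReal.ofReal k * c⁻¹)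
    (mul_ne_zero (ENNReal.ofReal_pos.2 hk).ne' (ENNReal.inv_ne_zero.2 hc'))
    (ENNReal.mul_ne_top ENNReal.ofReal_ne_top (ENNReal.inv_ne_top.2 hc)) ?_
  rw [withDensity_const_mul_quadExp hk, h, smul_smul, mul_assoc, ENNReal.inv_mul_cancel hc hc',
    mul_one]

/-- Conjugacy of the Gaussian family for a Gaussian likelihood. -/
lemma posteriorMeasure_affineGaussian_eq (b b₀ : EuclideanSpace ℝ (Fin d))
    {B B₀ Λ Λ₀ : Matrix (Fin d) (Fin d) ℝ} {ℓ : Fin d → ℝ} (hΛ : Λ.IsSymm) (hΛ₀ : Λ₀.IsSymm)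
    (hB₀ : Λ₀ * (B₀ * B₀ᵀ) = 1) (hB : (Λ + Λ₀) * (B * Bᵀ) = 1)
    (hb : (Λ + Λ₀) *ᵥ b.ofLp = ℓ + Λ₀ *ᵥ b₀.ofLp) {k : ℝ} (hk : 0 < k) :
    posteriorMeasure (fun θ ↦ k * quadExp Λ ℓ θ) (affineGaussian b₀ B₀) =
      affineGaussian b B := by
  obtain ⟨c₀, hc₀, hc₀', h₀⟩ := exists_affineGaussian_eq b₀ hΛ₀ hB₀
  obtain ⟨c, hc, hc', h⟩ := exists_affineGaussian_eq b (hΛ.add hΛ₀) hB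
  refine posteriorMeasure_eq (c := ENNReal.ofReal k * c₀ * c⁻¹)
    (mul_ne_zero (mul_ne_zero (ENNReal.ofReal_pos.2 hk).ne' hc₀) (ENNReal.inv_ne_zero.2 hc'))
    (ENNReal.mul_ne_top (ENNReal.mul_ne_top ENNReal.ofReal_ne_top hc₀')
      (ENNReal.inv_ne_top.2 hc)) ?_
  rw [withDensity_const_mul_quadExp hk, h₀, withDensity_smul_measure,
    ← withDensity_mul _ (continuous_quadExp _ _).measurable.ennreal_ofReal
      (continuous_quadExp _ _).measurable.ennreal_ofReal, h, smul_smul, smul_smul, mul_assoc _ c⁻¹,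
    ENNReal.inv_mul_cancel hc hc', mul_one]
  congr 2
  ext θ
  rw [Pi.mul_apply, ← ENNReal.ofReal_mul (quadExp_pos _ _ _).le, quadExp_mul, hb, add_comm Λ₀,
    add_comm ℓ]

end Density

/-! ### Operator norms and nearby square roots. -/

section Coupling

variable {d : ℕ}

lemma opNorm_nonneg (A : Matrix (Fin d) (Fin d) ℝ) : 0 ≤ opNorm A := norm_nonneg _

lemma opNorm_mul_le (A B : Matrix (Fin d) (Fin d) ℝ) : opNorm (A * B) ≤ opNorm A * opNorm B := by
  rw [opNorm, map_mul]
  exact norm_mul_le _ _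

lemma opNorm_smul (c : ℝ) (A : Matrix (Fin d) (Fin d) ℝ) : opNorm (c • A) = |c| * opNorm A := by
  rw [opNorm, map_smul, norm_smul, Real.norm_eq_abs, opNorm]

open scoped Matrix.Norms.L2Operator in
lemma opNorm_mul_transpose_self (A : Matrix (Fin d) (Fin d) ℝ) :
    opNorm (A * Aᵀ) = opNorm A * opNorm A := by
  have h := CStarRing.norm_self_mul_star (x := A)
  rwa [Matrix.star_eq_conjTranspose, Matrix.conjTranspose_eq_transpose_of_trivial] at h

lemma isSymm_of_posDef {A : Matrix (Fin d) (Fin d) ℝ} (hA : A.PosDef) : A.IsSymm := by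
  have := hA.isHermitian
  rwa [Matrix.IsHermitian, Matrix.conjTranspose_eq_transpose_of_trivial] at this

lemma posDef_sqrt {A : Matrix (Fin d) (Fin d) ℝ} (hA : A.PosDef) : (CFC.sqrt A).PosDef := by
  have h : CFC.sqrt A * CFC.sqrt A = A := CFC.sqrt_mul_sqrt_self A hA.posSemidef.nonneg
  have hu : IsUnit (CFC.sqrt A) := by
    rw [Matrix.isUnit_iff_isUnit_det, isUnit_iff_ne_zero]
    intro h0
    have h1 := congrArg Matrix.det h
    rw [Matrix.det_mul, h0, mul_zero] at h1
    exact hA.det_pos.ne h1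
  rw [← Matrix.isStrictlyPositive_iff_posDef]
  exact hu.isStrictlyPositive (CFC.sqrt_nonneg A)

/-- By the C⋆-identity both norms square to that of M; N itself need not be symmetric. -/
lemma opNorm_eq_opNorm_sqrt {N M : Matrix (Fin d) (Fin d) ℝ} (h : N * Nᵀ = M) :
    opNorm N = opNorm (CFC.sqrt M) := by
  have hM : M.PosSemidef := by
    rw [← h, ← Matrix.conjTranspose_eq_transpose_of_trivial]
    exact Matrix.posSemidef_self_mul_conjTranspose N
  have hs : (CFC.sqrt M)ᵀ = CFC.sqrt M := by
    have := (Matrix.nonneg_iff_posSemidef.1 (CFC.sqrt_nonneg M)).isHermitian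
    rwa [Matrix.IsHermitian, Matrix.conjTranspose_eq_transpose_of_trivial] at this
  have h1 := opNorm_mul_transpose_self N
  have h2 := opNorm_mul_transpose_self (CFC.sqrt M)
  rw [hs, CFC.sqrt_mul_sqrt_self M hM.nonneg] at h2
  rw [h, h2] at h1
  exact ((mul_self_inj (opNorm_nonneg _) (opNorm_nonneg _)).1 h1).symm

/-- If y = G x + x, pairing with x gives ‖x‖² ≤ ⟨x, y⟩ ≤ ‖x‖ ‖y‖. -/
lemma opNorm_inv_add_one_le {G : Matrix (Fin d) (Fin d) ℝ} (hG : G.PosSemidef) :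
    opNorm (G + 1)⁻¹ ≤ 1 := by
  have hpd : (G + 1).PosDef := Matrix.PosDef.posSemidef_add hG Matrix.PosDef.one
  refine ContinuousLinearMap.opNorm_le_bound _ zero_le_one fun y ↦ ?_
  set x := Matrix.toEuclideanCLM (𝕜 := ℝ) (G + 1)⁻¹ y with hx
  have hy : y = Matrix.toEuclideanCLM (𝕜 := ℝ) G x + x := by
    have h1 : Matrix.toEuclideanCLM (𝕜 := ℝ) (G + 1) x = y := by
      rw [hx, ← mul_apply_eq_comp, ← map_mul,
        Matrix.mul_nonsing_inv _ ((Matrix.isUnit_iff_isUnit_det _).1 hpd.isUnit), map_one]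
      rfl
    rw [← h1, map_add, map_one]
    rfl
  have h0 : 0 ≤ inner ℝ x (Matrix.toEuclideanCLM (𝕜 := ℝ) G x) := by
    rw [Matrix.inner_toEuclideanCLM]
    simpa using hG.dotProduct_mulVec_nonneg x.ofLp
  have h1 : ‖x‖ * ‖x‖ ≤ ‖x‖ * ‖y‖ := by
    refine le_trans ?_ (real_inner_le_norm x y)
    conv_rhs => rw [hy]
    rw [inner_add_right, real_inner_self_eq_norm_mul_norm]
    linarith
  rw [one_mul]
  rcases (norm_nonneg x).eq_or_lt with h | h
  · rw [← h]
    exact norm_nonneg y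
  · exact le_of_mul_le_mul_left h1 h

/-- Square roots of the covariance matrices `T⁻¹` and `(T + U)⁻¹` can be chosen close to each
other. -/
lemma exists_sqrt_close {T U : Matrix (Fin d) (Fin d) ℝ} (hT : T.PosDef) (hU : U.PosDef) :
    ∃ A B : Matrix (Fin d) (Fin d) ℝ, T * (A * Aᵀ) = 1 ∧ (T + U) * (B * Bᵀ) = 1 ∧
      opNorm (A - B) ≤ opNorm T⁻¹ * opNorm (CFC.sqrt (U * (T + U)⁻¹ * U)) := by
  obtain ⟨R, hR, hRR⟩ : ∃ R : Matrix (Fin d) (Fin d) ℝ, R.PosDef ∧ R * R = T⁻¹ :=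
    ⟨_, posDef_sqrt hT.inv, CFC.sqrt_mul_sqrt_self _ hT.inv.posSemidef.nonneg⟩
  have hV : (1 + R * U * R).PosDef := by
    refine Matrix.PosDef.one.add_posSemidef ?_
    have := hU.posSemidef.mul_mul_conjTranspose_same R
    rwa [hR.isHermitian.eq] at this
  obtain ⟨G, hG, hGG⟩ : ∃ G : Matrix (Fin d) (Fin d) ℝ, G.PosDef ∧ G * G = 1 + R * U * R :=
    ⟨_, posDef_sqrt hV, CFC.sqrt_mul_sqrt_self _ hV.posSemidef.nonneg⟩
  have hG1 : (G + 1).PosDef := Matrix.PosDef.posSemidef_add hG.posSemidef Matrix.PosDef.one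
  have hTR : T * (R * R) = 1 := by
    rw [hRR, Matrix.mul_nonsing_inv _ ((Matrix.isUnit_iff_isUnit_det _).1 hT.isUnit)]
  have hRTR : R * T * R = 1 := by
    rw [mul_assoc, mul_eq_one_comm, mul_assoc, hTR]
  have hGi : G * G⁻¹ = 1 :=
    Matrix.mul_nonsing_inv _ ((Matrix.isUnit_iff_isUnit_det _).1 hG.isUnit)
  have hGi' : G⁻¹ * G = 1 := mul_eq_one_comm.1 hGi
  have hHi : (G + 1) * (G + 1)⁻¹ = 1 :=
    Matrix.mul_nonsing_inv _ ((Matrix.isUnit_iff_isUnit_det _).1 hG1.isUnit)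
  have hGit : (G⁻¹)ᵀ = G⁻¹ := isSymm_of_posDef hG.inv
  have hRt : Rᵀ = R := isSymm_of_posDef hR
  have hUt : Uᵀ = U := isSymm_of_posDef hU
  have hB : (T + U) * (R * G⁻¹ * (R * G⁻¹)ᵀ) = 1 := by
    rw [Matrix.transpose_mul, hGit, hRt]
    have h1 : R * (T + U) * R = G * G := by rw [hGG, mul_add, add_mul, hRTR]
    have h2 : R * ((T + U) * (R * G⁻¹ * G⁻¹)) = 1 := by
      calc R * ((T + U) * (R * G⁻¹ * G⁻¹)) = (R * (T + U) * R) * G⁻¹ * G⁻¹ := by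
            simp only [mul_assoc]
        _ = G * (G * G⁻¹) * G⁻¹ := by rw [h1]; simp only [mul_assoc]
        _ = 1 := by rw [hGi, mul_one, hGi]
    rw [mul_eq_one_comm] at h2
    rw [← h2]
    simp only [mul_assoc]
  refine ⟨R, R * G⁻¹, by rw [hRt, hTR], hB, ?_⟩
  -- This is 1 - G⁻¹ = (G² - 1) G⁻¹ (G + 1)⁻¹ multiplied by R, with G² - 1 = R U R and R² = T⁻¹.
  have hdiff : R - R * G⁻¹ = T⁻¹ * (U * R * G⁻¹) * (G + 1)⁻¹ := by
    have h1 : T⁻¹ * (U * R * G⁻¹) = R * ((1 - G⁻¹) * (G + 1)) := by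
      have h2 : R * U * R = G * G - 1 := by rw [hGG, add_sub_cancel_left]
      calc T⁻¹ * (U * R * G⁻¹) = R * ((R * U * R) * G⁻¹) := by rw [← hRR]; simp only [mul_assoc]
        _ = R * (G * (G * G⁻¹) - G⁻¹) := by rw [h2, sub_mul, one_mul, mul_assoc]
        _ = R * ((1 - G⁻¹) * (G + 1)) := by
          rw [hGi, mul_one, sub_mul, mul_add G⁻¹, hGi', one_mul, mul_one]
          congr 1
          abel
    rw [h1, mul_assoc, mul_assoc, hHi, mul_one, mul_sub, mul_one]
  have hinv : (T + U)⁻¹ = R * G⁻¹ * (R * G⁻¹)ᵀ := Matrix.inv_eq_right_inv hB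
  have hN : opNorm (U * R * G⁻¹) = opNorm (CFC.sqrt (U * (T + U)⁻¹ * U)) := by
    refine opNorm_eq_opNorm_sqrt ?_
    rw [hinv]
    simp only [Matrix.transpose_mul, hUt, hRt, hGit, mul_assoc]
  rw [hdiff, ← hN]
  calc _ ≤ opNorm T⁻¹ * opNorm (U * R * G⁻¹) * opNorm (G + 1)⁻¹ :=
        (opNorm_mul_le _ _).trans
          (mul_le_mul_of_nonneg_right (opNorm_mul_le _ _) (opNorm_nonneg _))
    _ ≤ _ := mul_le_of_le_one_right (mul_nonneg (opNorm_nonneg _) (opNorm_nonneg _))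
        (opNorm_inv_add_one_le hG.posSemidef)

end Coupling

end NormalPosterior

/-! ### The two posteriors and the final bound. -/

open NormalPosterior in
theorem mainTheorem11 (d n : ℕ) (hd : 1 ≤ d) (hn : 1 ≤ n)
    (S S₂ : Matrix (Fin d) (Fin d) ℝ) (hS : S.PosDef) (hS₂ : S₂.PosDef)
    (μ : EuclideanSpace ℝ (Fin d)) (x : Fin n → EuclideanSpace ℝ (Fin d)) :
    IsProbabilityMeasure (NormalPosterior.uniformPosterior S x) ∧
    IsProbabilityMeasure (NormalPosterior.normalPosterior S x μ S₂) ∧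
    (∀ h : EuclideanSpace ℝ (Fin d) → ℝ, LipschitzWith 1 h →
      Integrable h (NormalPosterior.uniformPosterior S x) ∧
      Integrable h (NormalPosterior.normalPosterior S x μ S₂)) ∧
    NormalPosterior.wassersteinDist (NormalPosterior.uniformPosterior S x)
        (NormalPosterior.normalPosterior S x μ S₂) ≤
      ENNReal.ofReal
        (NormalPosterior.opNorm S * NormalPosterior.opNorm (S + (n : ℝ) • S₂)⁻¹ *
            ‖NormalPosterior.sampleMean x - μ‖ +
          Real.sqrt 2 * Real.Gamma ((d : ℝ) / 2 + 1 / 2) / Real.Gamma ((d : ℝ) / 2) *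
            (NormalPosterior.opNorm S / (n : ℝ)) *
            NormalPosterior.opNorm
              (NormalPosterior.invSqrt (S₂ + (n : ℝ) • (S₂ * S⁻¹ * S₂)))) := by
  have hn0 : (0 : ℝ) < n := by exact_mod_cast hn
  have : Nontrivial (EuclideanSpace ℝ (Fin d)) := by
    have : Nonempty (Fin d) := ⟨⟨0, hd⟩⟩
    infer_instance
  have hSS : S⁻¹ * S = 1 :=
    Matrix.nonsing_inv_mul _ ((Matrix.isUnit_iff_isUnit_det _).1 hS.isUnit)
  have hSS₂ : S₂⁻¹ * S₂ = 1 :=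
    Matrix.nonsing_inv_mul _ ((Matrix.isUnit_iff_isUnit_det _).1 hS₂.isUnit)
  have hT : ((n : ℝ) • S⁻¹).PosDef := hS.inv.smul hn0
  have hTi : ((n : ℝ) • S⁻¹)⁻¹ = (n : ℝ)⁻¹ • S := by
    refine Matrix.inv_eq_right_inv ?_
    rw [smul_mul_smul_comm, hSS, mul_inv_cancel₀ hn0.ne', one_smul]
  have hsum : ((S + (n : ℝ) • S₂)).PosDef := hS.add (hS₂.smul hn0)
  have hsum' : (S + (n : ℝ) • S₂) * (S + (n : ℝ) • S₂)⁻¹ = 1 :=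
    Matrix.mul_nonsing_inv _ ((Matrix.isUnit_iff_isUnit_det _).1 hsum.isUnit)
  obtain ⟨A, B, hA, hB, hAB⟩ := exists_sqrt_close hT hS₂.inv
  obtain ⟨k, hk, hL⟩ := exists_likelihood_eq hS x
  set xb := sampleMean x with hxb
  have hℓ : ∑ i, S⁻¹ *ᵥ (x i).ofLp = ((n : ℝ) • S⁻¹) *ᵥ xb.ofLp := by
    rw [hxb, sampleMean, WithLp.ofLp_smul, WithLp.ofLp_sum, Matrix.smul_mulVec,
      Matrix.mulVec_smul, smul_smul, mul_inv_cancel₀ hn0.ne', one_smul, Matrix.mulVec_sum]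
  rw [hℓ] at hL
  -- The shift of the posterior mean: it solves (n S⁻¹ + S₂⁻¹) δ = S₂⁻¹ (x̄ - μ).
  set δ := Matrix.toEuclideanCLM (𝕜 := ℝ) (S * (S + (n : ℝ) • S₂)⁻¹) (xb - μ) with hδ
  have hP₁ : uniformPosterior S x = affineGaussian xb A := by
    rw [uniformPosterior, hL]
    exact posteriorMeasure_volume_eq xb (isSymm_of_posDef hT) hA hk
  have hP₂ : normalPosterior S x μ S₂ = affineGaussian (xb - δ) B := by
    rw [normalPosterior, hL]
    -- The prior unfolds to the affine image of the standard Gaussian under z ↦ μ + √S₂ z, hence the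
    -- choice of `B₀`.
    refine posteriorMeasure_affineGaussian_eq (xb - δ) μ (isSymm_of_posDef hT)
      (isSymm_of_posDef hS₂.inv) (B₀ := CFC.sqrt S₂) ?_ hB ?_ hk
    · rw [isSymm_of_posDef (posDef_sqrt hS₂), CFC.sqrt_mul_sqrt_self _ hS₂.posSemidef.nonneg,
        hSS₂]
    · have h1 : ((n : ℝ) • S⁻¹ + S₂⁻¹) * (S * (S + (n : ℝ) • S₂)⁻¹) = S₂⁻¹ := by
        have h2 : ((n : ℝ) • S⁻¹ + S₂⁻¹) * S = S₂⁻¹ * (S + (n : ℝ) • S₂) := by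
          rw [add_mul, mul_add, smul_mul_assoc, hSS, mul_smul_comm, hSS₂, add_comm]
        rw [← mul_assoc, h2, mul_assoc, hsum', mul_one]
      rw [hδ, WithLp.ofLp_sub, Matrix.ofLp_toEuclideanCLM, Matrix.mulVec_sub, Matrix.mulVec_mulVec,
        h1, WithLp.ofLp_sub, Matrix.mulVec_sub, Matrix.add_mulVec]
      abel
  rw [hP₁, hP₂]
  refine ⟨inferInstance, inferInstance,
    fun h hh ↦ ⟨integrable_affineGaussian _ _ hh, integrable_affineGaussian _ _ hh⟩, ?_⟩
  refine (wassersteinDist_map_affine_le integrable_norm_stdGaussian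
    (fun h K hh ↦ integrable_stdGaussian_of_lipschitzWith hh) _ _ _ _).trans
    (ENNReal.ofReal_le_ofReal (add_le_add ?_ ?_))
  · rw [sub_sub_cancel, hδ]
    exact (ContinuousLinearMap.le_opNorm _ _).trans
      (mul_le_mul_of_nonneg_right (opNorm_mul_le _ _) (norm_nonneg _))
  · have hM : S₂⁻¹ * ((n : ℝ) • S⁻¹ + S₂⁻¹)⁻¹ * S₂⁻¹ =
        (S₂ + (n : ℝ) • (S₂ * S⁻¹ * S₂))⁻¹ := by
      have h1 : S₂ + (n : ℝ) • (S₂ * S⁻¹ * S₂) = S₂ * (((n : ℝ) • S⁻¹ + S₂⁻¹) * S₂) := by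
        rw [add_mul, hSS₂, mul_add, mul_one, smul_mul_assoc, mul_smul_comm, mul_assoc, add_comm]
      rw [h1, Matrix.mul_inv_rev, Matrix.mul_inv_rev]
    rw [hM, hTi, opNorm_smul, abs_of_pos (inv_pos.2 hn0)] at hAB
    have hΓ : 0 ≤ Real.sqrt 2 * Real.Gamma ((d : ℝ) / 2 + 1 / 2) / Real.Gamma ((d : ℝ) / 2) := by
      have := Real.Gamma_nonneg_of_nonneg (s := (d : ℝ) / 2 + 1 / 2) (by positivity)
      have := Real.Gamma_nonneg_of_nonneg (s := (d : ℝ) / 2) (by positivity)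
      positivity
    rw [integral_norm_stdGaussian, finrank_euclideanSpace, Fintype.card_fin, ← map_sub,
      mul_comm, mul_assoc]
    refine mul_le_mul_of_nonneg_left ?_ hΓ
    rwa [invSqrt, div_eq_inv_mul]
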